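/- Let $D\subset\mathbb{R}^2$ be a bounded open set (for example a bounded, connected, polygonal domain) and let $T>0$. For $f\in C([0,T];L^2(D))$, a weak solution of the heat equation $\partial_t u-\Delta u=f$ with homogeneous Dirichlet boundary condition and zero initial value is a function $u\in C([0,T];L^2(D))\cap L^2(0,T;H_0^1(D))$ with $u(0)=0$ such that, for every $v\in H_0^1(D)$, $$\frac{d}{dt}(u(t),v)_{L^2(D)}+(\nabla u(t),\nabla v)_{L^2(D)}=(f(t),v)_{L^2(D)}$$ in the sense of distributions on $(0,T)$. Then there is a constant $C>0$, depending only on $D$ and $T$, such that the following holds. Let $f,g\in C([0,T];L^2(D))$, let $u$ be a weak solution with forcing $f$ and $w$ a weak solution with forcing $g$. Then for every integer $N\ge 1$ and every $m\in\{0,1,\ldots,N\}$, with $t_m=mT/N$, $u^m=u(t_m)$ and $w^m=w(t_m)$, $$\|u^m-w^m\|_{L^2(D)}\le C\,\|f-g\|_{C([0,T];L^2(D))},$$ where $\|h\|_{C([0,T];L^2(D))}=\max_{t\in[0,T]}\|h(t)\|_{L^2(D)}$. -/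

import Mathlib

open MeasureTheory
open scoped ContDiff

noncomputable section

namespace HeatPerturbation

/-- The Euclidean plane `ℝ²`. -/
abbrev Plane : Type := EuclideanSpace ℝ (Fin 2)

/-- The real Hilbert space `L²(D)`. -/
abbrev L2 (D : Set Plane) : Type := Lp ℝ 2 (volume.restrict D)

/-- The real Hilbert space `L²(D; ℝ²)` of square-integrable vector fields on `D`. -/
abbrev L2Vec (D : Set Plane) : Type := Lp Plane 2 (volume.restrict D)

/-- The Hilbert space `L²(D) × L²(D; ℝ²)`, with `‖(v, G)‖² = ‖v‖² + ‖G‖²`. When `G = ∇v` this is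
the square of the `H¹(D)`-norm of `v`. -/
abbrev L2Pair (D : Set Plane) : Type := WithLp 2 (L2 D × L2Vec D)

/-- `φ ∈ C_c^∞(U)`: a smooth function with compact support contained in `U`. -/
structure IsTestFunction {E : Type*} [NormedAddCommGroup E] [NormedSpace ℝ E]
    (U : Set E) (φ : E → ℝ) : Prop where
  smooth : ContDiff ℝ ∞ φ
  compact : HasCompactSupport φ
  support_subset : tsupport φ ⊆ U

theorem IsTestFunction.zero {E : Type*} [NormedAddCommGroup E] [NormedSpace ℝ E] (U : Set E) :
    IsTestFunction U (0 : E → ℝ) :=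
  ⟨contDiff_const, HasCompactSupport.zero, by simp [tsupport]⟩

theorem IsTestFunction.add {E : Type*} [NormedAddCommGroup E] [NormedSpace ℝ E] {U : Set E}
    {φ ψ : E → ℝ} (hφ : IsTestFunction U φ) (hψ : IsTestFunction U ψ) :
    IsTestFunction U (φ + ψ) :=
  ⟨hφ.smooth.add hψ.smooth, hφ.compact.add hψ.compact,
    (tsupport_add φ ψ).trans (Set.union_subset hφ.support_subset hψ.support_subset)⟩

theorem IsTestFunction.smul {E : Type*} [NormedAddCommGroup E] [NormedSpace ℝ E] {U : Set E}
    {φ : E → ℝ} (hφ : IsTestFunction U φ) (c : ℝ) : IsTestFunction U (c • φ) :=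
  ⟨hφ.smooth.const_smul c, hφ.compact.smul_left (f := fun _ => c),
    (tsupport_smul_subset_right (fun _ => c) φ).trans hφ.support_subset⟩

/-- The subspace of all pairs `(φ, ∇φ)` with `φ ∈ C_c^∞(D)`. -/
def testPairs (D : Set Plane) : Submodule ℝ (L2Pair D) where
  carrier := {p | ∃ φ : Plane → ℝ, IsTestFunction D φ ∧
    p.fst =ᵐ[volume.restrict D] φ ∧ p.snd =ᵐ[volume.restrict D] gradient φ}
  zero_mem' := by
    refine ⟨0, IsTestFunction.zero D, Lp.coeFn_zero _ _ _, ?_⟩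
    have h : gradient (0 : Plane → ℝ) = 0 := by
      funext x
      simp [gradient]
    rw [h]
    exact Lp.coeFn_zero _ _ _
  add_mem' := by
    rintro p q ⟨φ, hφ, hp1, hp2⟩ ⟨ψ, hψ, hq1, hq2⟩
    refine ⟨φ + ψ, hφ.add hψ, (Lp.coeFn_add p.fst q.fst).trans (hp1.add hq1), ?_⟩
    have h : gradient (φ + ψ) = gradient φ + gradient ψ := by
      funext x
      simp [gradient, fderiv_add (hφ.smooth.differentiable (by simp) x)
        (hψ.smooth.differentiable (by simp) x)]
    rw [h]
    exact (Lp.coeFn_add p.snd q.snd).trans (hp2.add hq2)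
  smul_mem' := by
    rintro c p ⟨φ, hφ, hp1, hp2⟩
    refine ⟨c • φ, hφ.smul c, (Lp.coeFn_smul c p.fst).trans (hp1.const_smul c), ?_⟩
    have h : gradient (c • φ) = c • gradient φ := by
      funext x
      simp [gradient, fderiv_const_smul (hφ.smooth.differentiable (by simp) x)]
    rw [h]
    exact (Lp.coeFn_smul c p.snd).trans (hp2.const_smul c)

/-- The Sobolev space `H₀¹(D)`: the closure of `C_c^∞(D)` in the `H¹`-norm. An element is stored
as the pair `(v, ∇v)` of a function `v ∈ L²(D)` and its weak gradient `∇v ∈ L²(D; ℝ²)`; since weak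
gradients are unique and stable under `L²`-limits, `v` determines the pair. -/
def H01 (D : Set Plane) : Submodule ℝ (L2Pair D) := (testPairs D).topologicalClosure

/-- The underlying function of `v ∈ H₀¹(D)`, as an element of `L²(D)`. -/
def H01.toL2 {D : Set Plane} (v : H01 D) : L2 D := (v : L2Pair D).fst

/-- The weak gradient of `v ∈ H₀¹(D)`. -/
def H01.grad {D : Set Plane} (v : H01 D) : L2Vec D := (v : L2Pair D).snd

/-- Lebesgue measure on the time interval `[0, T]`. -/
abbrev timeMeasure (T : ℝ) : Measure (Set.Icc (0 : ℝ) T) :=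
  (volume : Measure ℝ).comap Subtype.val

/-- `b` is the derivative of `a` in the sense of distributions on `(0, T)`:
`∫ a φ' = - ∫ b φ` for all `φ ∈ C_c^∞((0, T))`. -/
def HasDistribDeriv {T : ℝ} (a b : Set.Icc (0 : ℝ) T → ℝ) : Prop :=
  ∀ φ : ℝ → ℝ, IsTestFunction (Set.Ioo 0 T) φ →
    ∫ t, a t * deriv φ (t : ℝ) ∂(timeMeasure T) = - ∫ t, b t * φ (t : ℝ) ∂(timeMeasure T)

/-- `u` is the weak solution of the heat equation `∂ₜu - Δu = f` on `D × (0, T]` with homogeneous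
Dirichlet boundary condition and zero initial value, for a forcing `f ∈ C([0, T]; L²(D))`. It lies
in `L²(0, T; H₀¹(D))` (through `U`) and is given by its representative in `C([0, T]; L²(D))`.
The equation `(∂ₜu, v) + (∇u, ∇v) = (f, v)` for all `v ∈ H₀¹(D)` holds with `∂ₜ` taken in
the sense of distributions on `(0, T)`. -/
structure IsWeakSolution (D : Set Plane) {T : ℝ} (hT : 0 < T)
    (f u : C(Set.Icc (0 : ℝ) T, L2 D)) : Prop where
  equation : ∃ U : Lp (H01 D) 2 (timeMeasure T),
    (∀ᵐ t ∂(timeMeasure T), H01.toL2 (U t) = u t) ∧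
    ∀ v : H01 D, HasDistribDeriv
      (fun t => inner ℝ (u t) (H01.toL2 v))
      (fun t => inner ℝ (f t) (H01.toL2 v) - inner ℝ (H01.grad (U t)) (H01.grad v))
  initial : u ⟨0, Set.left_mem_Icc.2 hT.le⟩ = 0

/-- The time node `t_m = m k`, where `k = T / N` is the time step and `m = 0, …, N`. -/
def timeNode {T : ℝ} (hT : 0 < T) (N : ℕ) (m : Fin (N + 1)) : Set.Icc (0 : ℝ) T :=
  ⟨(m : ℕ) * (T / N), by positivity, by
    rcases Nat.eq_zero_or_pos N with rfl | hN
    · simp [hT.le]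
    · have hN' : (0 : ℝ) < N := by exact_mod_cast hN
      have hm : ((m : ℕ) : ℝ) ≤ N := by exact_mod_cast Nat.lt_succ_iff.1 m.2
      rw [mul_div_assoc', div_le_iff₀ hN', mul_comm]
      exact mul_le_mul_of_nonneg_left hm hT.le⟩

end HeatPerturbation

end

namespace HeatPerturbation

open Filter Topology

/-! By linearity z = u - w solves the heat equation with forcing f - g and z(0) = 0. Testing with z
itself gives (z', z) + ‖∇z‖² = (f - g, z) ≤ ‖f - g‖ ‖z‖; dropping the gradient term and applying
Gronwall bounds ‖z(t)‖ by e^T ‖f - g‖. A weak solution is only continuous in time, so z' need not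
exist in L². Everything is therefore mollified in time: the mollified z is differentiable and the
mollified U takes values in H₀¹(D), so testing is legitimate (`mollified_energy`,
`gronwall_norm_sq`). The kernel must stay inside (0, T), which yields the estimate between interior
times only (`energy_interior`); continuity of z then reaches t = 0 and t = T (`energy_estimate`). -/

instance isFiniteMeasure_timeMeasure (T : ℝ) : IsFiniteMeasure (timeMeasure T) := by
  refine ⟨?_⟩
  rw [(MeasurableEmbedding.subtype_coe measurableSet_Icc).comap_apply]
  refine lt_of_le_of_lt (measure_mono (t := Set.Icc 0 T) ?_) (by simp)
  rintro _ ⟨x, -, rfl⟩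
  exact x.2

/-- Needed for Bochner integrals with values in H₀¹(D), hence for mollifying U. -/
instance completeSpace_H01 (D : Set Plane) : CompleteSpace (H01 D) :=
  (testPairs D).isClosed_topologicalClosure.completeSpace_coe

/-- The inclusion `H₀¹(D) → L²(D)`. -/
noncomputable def toL2L (D : Set Plane) : H01 D →L[ℝ] L2 D :=
  (WithLp.fstL 2 ℝ (L2 D) (L2Vec D)).comp (H01 D).subtypeL

/-- The weak gradient `H₀¹(D) → L²(D; ℝ²)`. -/
noncomputable def gradL (D : Set Plane) : H01 D →L[ℝ] L2Vec D :=
  (WithLp.sndL 2 ℝ (L2 D) (L2Vec D)).comp (H01 D).subtypeL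

theorem toL2L_apply {D : Set Plane} (v : H01 D) : toL2L D v = H01.toL2 v := rfl

theorem gradL_apply {D : Set Plane} (v : H01 D) : gradL D v = H01.grad v := rfl

/-! ### Mollification in time -/

section Mollify

variable {E : Type*} [NormedAddCommGroup E] [NormedSpace ℝ E] {T : ℝ}

/-- The convolution in time of `F : [0, T] → E` with the kernel `η`. -/
noncomputable def mollify (η : ℝ → ℝ) (F : Set.Icc (0 : ℝ) T → E) (t : ℝ) : E :=
  ∫ s, η (t - s) • F s ∂(timeMeasure T)

theorem integrable_kernel_smul {η : ℝ → ℝ} (hη : Continuous η) (hc : HasCompactSupport η)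
    {F : Set.Icc (0 : ℝ) T → E} (hF : Integrable F (timeMeasure T)) (t : ℝ) :
    Integrable (fun s : Set.Icc (0 : ℝ) T => η (t - s) • F s) (timeMeasure T) := by
  obtain ⟨K, hK⟩ := hc.exists_bound_of_continuous hη
  exact hF.bdd_smul K
    (by fun_prop : Continuous fun s : Set.Icc (0 : ℝ) T => η (t - s)).aestronglyMeasurable
    (Eventually.of_forall fun s => hK _)

/-- The derivative falls on the kernel, so F need only be integrable. -/
theorem hasDerivAt_mollify {η : ℝ → ℝ} (hη : ContDiff ℝ ∞ η) (hc : HasCompactSupport η)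
    {F : Set.Icc (0 : ℝ) T → E} (hF : Integrable F (timeMeasure T)) (t : ℝ) :
    HasDerivAt (mollify η F) (mollify (deriv η) F t) t := by
  have hd : Continuous (deriv η) := hη.continuous_deriv (by simp)
  obtain ⟨K, hK⟩ := hc.deriv.exists_bound_of_continuous hd
  refine (hasDerivAt_integral_of_dominated_loc_of_deriv_le (s := Set.univ)
    (bound := fun s => K * ‖F s‖) (F := fun t (s : Set.Icc (0 : ℝ) T) => η (t - s) • F s)
    (F' := fun t (s : Set.Icc (0 : ℝ) T) => deriv η (t - s) • F s) univ_mem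
    (Eventually.of_forall fun x =>
      (integrable_kernel_smul hη.continuous hc hF x).aestronglyMeasurable)
    (integrable_kernel_smul hη.continuous hc hF t)
    (integrable_kernel_smul hd hc.deriv hF t).aestronglyMeasurable
    (Eventually.of_forall fun s x _ => ?_) (hF.norm.const_mul K)
    (Eventually.of_forall fun s x _ => ?_)).2
  · rw [norm_smul]
    exact mul_le_mul_of_nonneg_right (hK _) (norm_nonneg _)
  · have h1 : HasDerivAt η (deriv η (x - s)) (x - s) :=
      (hη.differentiable (by simp) _).hasDerivAt
    exact (h1.comp_sub_const x (s : ℝ)).smul_const (F s)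

theorem mollify_sub {η : ℝ → ℝ} (hη : Continuous η) (hc : HasCompactSupport η)
    {F G : Set.Icc (0 : ℝ) T → E} (hF : Integrable F (timeMeasure T))
    (hG : Integrable G (timeMeasure T)) (t : ℝ) :
    mollify η (fun s => F s - G s) t = mollify η F t - mollify η G t := by
  simp only [mollify, smul_sub]
  exact integral_sub (integrable_kernel_smul hη hc hF t) (integrable_kernel_smul hη hc hG t)

theorem mollify_comp_clm {E' : Type*} [NormedAddCommGroup E'] [NormedSpace ℝ E']
    [CompleteSpace E] [CompleteSpace E'] (L : E →L[ℝ] E') {η : ℝ → ℝ} (hη : Continuous η)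
    (hc : HasCompactSupport η) {F : Set.Icc (0 : ℝ) T → E} (hF : Integrable F (timeMeasure T))
    (t : ℝ) : mollify η (fun s => L (F s)) t = L (mollify η F t) := by
  rw [mollify, mollify, ← L.integral_comp_comm (integrable_kernel_smul hη hc hF t)]
  simp

/-- At distance at least r from both endpoints the kernel vanishes outside [0, T], so the values of
the extension there play no role. This gives access to convergence of approximate identities. -/
theorem mollify_eq_convolution {η : ℝ → ℝ} {r t : ℝ}
    (hsupp : Function.support η ⊆ Metric.ball 0 r) (h0 : r ≤ t) (h1 : t + r ≤ T) (hT : 0 ≤ T)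
    (F : Set.Icc (0 : ℝ) T → E) :
    mollify η F t =
      (convolution η (Set.IccExtend hT F) (ContinuousLinearMap.lsmul ℝ ℝ) volume) t := by
  rw [convolution_eq_swap]
  have h : mollify η F t = ∫ s in Set.Icc 0 T, η (t - s) • Set.IccExtend hT F s := by
    rw [← integral_subtype_comap measurableSet_Icc
      (fun s => η (t - s) • Set.IccExtend hT F s)]
    simp [mollify]
  rw [h]
  refine setIntegral_eq_integral_of_forall_compl_eq_zero fun s hs => ?_
  have : η (t - s) = 0 := by
    by_contra hne
    have := hsupp (show t - s ∈ Function.support η from hne)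
    rw [mem_ball_zero_iff, Real.norm_eq_abs, abs_lt] at this
    exact hs ⟨by linarith, by linarith⟩
  rw [this, zero_smul]

/-- Restricted to [0, T], the nonnegative kernel has mass at most 1. -/
theorem norm_mollify_le {η : ℝ → ℝ} (hη : Continuous η) (hc : HasCompactSupport η)
    (hpos : ∀ x, 0 ≤ η x) (hint : ∫ x, η x = 1)
    {F : Set.Icc (0 : ℝ) T → E} {M : ℝ} (hM0 : 0 ≤ M) (hM : ∀ s, ‖F s‖ ≤ M) (t : ℝ) :
    ‖mollify η F t‖ ≤ M := by
  have hi : Integrable (fun s => η (t - s) * M) volume :=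
    ((hη.integrable_of_hasCompactSupport hc).comp_sub_left t).mul_const M
  have hm := MeasurableEmbedding.subtype_coe (measurableSet_Icc (a := (0 : ℝ)) (b := T))
  calc ‖mollify η F t‖ ≤ ∫ s : Set.Icc (0 : ℝ) T, η (t - s) * M ∂(timeMeasure T) := by
        refine norm_integral_le_of_norm_le ?_ (Eventually.of_forall fun s => ?_)
        · simpa using integrable_kernel_smul hη hc (integrable_const (μ := timeMeasure T) M) t
        · rw [norm_smul, Real.norm_of_nonneg (hpos _)]
          exact mul_le_mul_of_nonneg_left (hM s) (hpos _)
    _ = ∫ s in Set.Icc 0 T, η (t - s) * M :=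
        integral_subtype_comap measurableSet_Icc (fun s => η (t - s) * M)
    _ ≤ ∫ s, η (t - s) * M :=
        setIntegral_le_integral hi (Eventually.of_forall fun s => mul_nonneg (hpos _) hM0)
    _ = M := by
        rw [integral_mul_const, integral_sub_left_eq_self η volume t, hint, one_mul]

end Mollify

theorem isTestFunction_kernel {η : ℝ → ℝ} (hη : ContDiff ℝ ∞ η) {r t T : ℝ}
    (hsupp : tsupport η ⊆ Metric.closedBall 0 r) (h0 : r < t) (h1 : t + r < T) :
    IsTestFunction (Set.Ioo 0 T) (fun s => η (t - s)) := by
  have hsub : tsupport (fun s => η (t - s)) ⊆ Set.Icc (t - r) (t + r) := by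
    refine closure_minimal (fun s hs => ?_) isClosed_Icc
    have := hsupp (subset_tsupport η (show t - s ∈ Function.support η from hs))
    rw [mem_closedBall_zero_iff, Real.norm_eq_abs, abs_le] at this
    exact ⟨by linarith, by linarith⟩
  refine ⟨hη.comp (contDiff_const.sub contDiff_id), ?_, hsub.trans fun s hs => ?_⟩
  · exact isCompact_Icc.of_isClosed_subset (isClosed_tsupport _) hsub
  · exact ⟨by linarith [hs.1], by linarith [hs.2]⟩

theorem integrable_continuousMap {E : Type*} [NormedAddCommGroup E] {T : ℝ}
    (f : C(Set.Icc (0 : ℝ) T, E)) : Integrable f (timeMeasure T) :=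
  f.continuous.integrable_of_hasCompactSupport (HasCompactSupport.of_compactSpace f)

theorem integrable_Lp_two {E : Type*} [NormedAddCommGroup E] {T : ℝ}
    (U : Lp E 2 (timeMeasure T)) : Integrable U (timeMeasure T) :=
  (Lp.memLp U).integrable (by norm_num)

/-- The weak formulation, mollified in time. -/
theorem mollified_equation {D : Set Plane} {T : ℝ} {f u : C(Set.Icc (0 : ℝ) T, L2 D)}
    {U : Lp (H01 D) 2 (timeMeasure T)} (v : H01 D)
    (hU : HasDistribDeriv (fun t => inner ℝ (u t) (H01.toL2 v))
      (fun t => inner ℝ (f t) (H01.toL2 v) - inner ℝ (H01.grad (U t)) (H01.grad v)))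
    {η : ℝ → ℝ} (hη : ContDiff ℝ ∞ η) (hc : HasCompactSupport η) {r t : ℝ}
    (hsupp : tsupport η ⊆ Metric.closedBall 0 r) (h0 : r < t) (h1 : t + r < T) :
    inner ℝ (mollify (deriv η) u t) (H01.toL2 v) =
      inner ℝ (mollify η f t) (H01.toL2 v) -
        inner ℝ (H01.grad (mollify η U t)) (H01.grad v) := by
  have hd : Continuous (deriv η) := hη.continuous_deriv (by simp)
  have key := hU _ (isTestFunction_kernel hη hsupp h0 h1)
  -- The sign from reflecting the kernel cancels the one in the distributional derivative.
  have hderiv : ∀ s : ℝ, deriv (fun s => η (t - s)) s = - deriv η (t - s) := fun s =>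
    deriv_comp_const_sub η t s
  have hUi := integrable_Lp_two U
  rw [← gradL_apply (mollify η U t), ← mollify_comp_clm _ hη.continuous hc hUi,
    real_inner_comm, real_inner_comm (H01.toL2 v), real_inner_comm (H01.grad v)]
  simp only [mollify]
  have hg := integrable_kernel_smul hη.continuous hc ((gradL D).integrable_comp hUi) t
  have hf := integrable_kernel_smul hη.continuous hc (integrable_continuousMap f) t
  rw [← integral_inner (integrable_kernel_smul hd hc.deriv (integrable_continuousMap u) t),
    ← integral_inner hf, ← integral_inner hg, ← integral_sub (hf.const_inner _)
      (hg.const_inner _)]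
  simp only [hderiv, mul_neg, integral_neg, neg_inj] at key
  refine Eq.trans ?_ (key.trans ?_) <;> refine integral_congr_ae (Eventually.of_forall fun s => ?_)
  · simp only [real_inner_smul_right, real_inner_comm (u s)]
    ring
  · simp only [real_inner_smul_right, real_inner_comm (f s), gradL_apply,
      real_inner_comm (H01.grad (U s))]
    ring

/-- A Gronwall estimate in a real inner product space. -/
theorem gronwall_norm_sq {E : Type*} [NormedAddCommGroup E] [InnerProductSpace ℝ E]
    {z z' : ℝ → E} {a b M : ℝ} (hz : ∀ t, HasDerivAt z (z' t) t)
    (h : ∀ t ∈ Set.Icc a b, inner ℝ (z' t) (z t) ≤ M * ‖z t‖) (hab : a ≤ b) :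
    Real.exp (-b) * (‖z b‖ ^ 2 + M ^ 2) ≤ Real.exp (-a) * (‖z a‖ ^ 2 + M ^ 2) := by
  -- Adding M² completes the square: the derivative is at most -e^(-t) (M - ‖z‖)², and no division
  -- by ‖z‖ is needed.
  have hd : ∀ t, HasDerivAt (fun t => Real.exp (-t) * (‖z t‖ ^ 2 + M ^ 2))
      (Real.exp (-t) * (-1) * (‖z t‖ ^ 2 + M ^ 2) +
        Real.exp (-t) * (2 * inner ℝ (z t) (z' t))) t := fun t =>
    (hasDerivAt_neg t).exp.mul ((hz t).norm_sq.add_const _)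
  refine antitoneOn_of_deriv_nonpos (convex_Icc a b)
    (fun t _ => (hd t).continuousAt.continuousWithinAt)
    (fun t _ => (hd t).differentiableAt.differentiableWithinAt) (fun t ht => ?_)
    (Set.left_mem_Icc.2 hab) (Set.right_mem_Icc.2 hab) hab
  have h1 := h t (interior_subset ht)
  rw [(hd t).deriv, real_inner_comm, mul_assoc, ← mul_add]
  exact mul_nonpos_of_nonneg_of_nonpos (Real.exp_pos _).le
    (by nlinarith [sq_nonneg (M - ‖z t‖)])

/-- The energy estimate for the difference of two mollified solutions. -/
theorem mollified_energy {D : Set Plane} {T : ℝ} (hT : 0 < T)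
    {f g u w : C(Set.Icc (0 : ℝ) T, L2 D)} (hu : IsWeakSolution D hT f u)
    (hw : IsWeakSolution D hT g w) {η : ℝ → ℝ} (hη : ContDiff ℝ ∞ η)
    (hc : HasCompactSupport η) (hpos : ∀ x, 0 ≤ η x) (hint : ∫ x, η x = 1) {r a b : ℝ}
    (hsupp : tsupport η ⊆ Metric.closedBall 0 r) (h0 : r < a) (hab : a ≤ b) (h1 : b + r < T) :
    Real.exp (-b) * (‖mollify η (u - w) b‖ ^ 2 + ‖f - g‖ ^ 2) ≤
      Real.exp (-a) * (‖mollify η (u - w) a‖ ^ 2 + ‖f - g‖ ^ 2) := by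
  obtain ⟨U, hUu, hU⟩ := hu.equation
  obtain ⟨W, hWw, hW⟩ := hw.equation
  refine gronwall_norm_sq (fun t => hasDerivAt_mollify hη hc (integrable_continuousMap (u - w)) t)
    (fun t ht => ?_) hab
  have h0t : r < t := h0.trans_le ht.1
  have h1t : t + r < T := by linarith [ht.2]
  have hd : Continuous (deriv η) := hη.continuous_deriv (by simp)
  -- The time t is frozen, so the mollified difference at t is an admissible test element.
  set v : H01 D := mollify η U t - mollify η W t with hv
  have hval : ∀ {u : C(Set.Icc (0 : ℝ) T, L2 D)} {U : Lp (H01 D) 2 (timeMeasure T)},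
      (∀ᵐ t ∂(timeMeasure T), H01.toL2 (U t) = u t) →
      toL2L D (mollify η U t) = mollify η u t := fun {u U} h => by
    rw [← mollify_comp_clm _ hη.continuous hc (integrable_Lp_two U)]
    refine integral_congr_ae ?_
    filter_upwards [h] with s hs
    rw [toL2L_apply, hs]
  have hzsub : mollify η (u - w) t = mollify η u t - mollify η w t :=
    mollify_sub hη.continuous hc (integrable_continuousMap u) (integrable_continuousMap w) t
  have hfsub : mollify η (f - g) t = mollify η f t - mollify η g t :=
    mollify_sub hη.continuous hc (integrable_continuousMap f) (integrable_continuousMap g) t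
  have hz : mollify η (u - w) t = H01.toL2 v := by
    rw [hzsub, ← toL2L_apply, hv, map_sub, hval hUu, hval hWw]
  have hdz : mollify (deriv η) (u - w) t = mollify (deriv η) u t - mollify (deriv η) w t :=
    mollify_sub hd hc.deriv (integrable_continuousMap u) (integrable_continuousMap w) t
  have hgrad : H01.grad v = H01.grad (mollify η U t) - H01.grad (mollify η W t) := by
    rw [← gradL_apply, hv, map_sub, gradL_apply, gradL_apply]
  have hbound : ‖mollify η (f - g) t‖ ≤ ‖f - g‖ :=
    norm_mollify_le hη.continuous hc hpos hint (norm_nonneg _)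
      (fun s => (f - g).norm_coe_le_norm s) t
  have e1 := mollified_equation v (hU v) hη hc hsupp h0t h1t
  have e2 := mollified_equation v (hW v) hη hc hsupp h0t h1t
  have e3 : inner ℝ (mollify (deriv η) (u - w) t) (H01.toL2 v) =
      inner ℝ (mollify η (f - g) t) (H01.toL2 v) - inner ℝ (H01.grad v) (H01.grad v) := by
    rw [hdz, hfsub]
    conv_rhs => rw [show inner ℝ (H01.grad v) (H01.grad v) =
      inner ℝ (H01.grad (mollify η U t) - H01.grad (mollify η W t)) (H01.grad v) by rw [← hgrad]]
    simp only [inner_sub_left, e1, e2]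
    ring
  rw [hz, e3]
  -- Cauchy–Schwarz handles the forcing; the gradient term has a favourable sign and is discarded.
  have h2 := real_inner_le_norm (mollify η (f - g) t) (H01.toL2 v)
  have h3 : 0 ≤ inner ℝ (H01.grad v) (H01.grad v) := real_inner_self_nonneg
  have h4 := mul_le_mul_of_nonneg_right hbound (norm_nonneg (H01.toL2 v))
  linarith

/-- The energy estimate for the difference of two weak solutions, between interior times. -/
theorem energy_interior {D : Set Plane} {T : ℝ} (hT : 0 < T)
    {f g u w : C(Set.Icc (0 : ℝ) T, L2 D)} (hu : IsWeakSolution D hT f u)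
    (hw : IsWeakSolution D hT g w) {a b : ℝ} (ha : 0 < a) (hab : a ≤ b) (hb : b < T) :
    Real.exp (-b) * (‖Set.IccExtend hT.le (u - w) b‖ ^ 2 + ‖f - g‖ ^ 2) ≤
      Real.exp (-a) * (‖Set.IccExtend hT.le (u - w) a‖ ^ 2 + ‖f - g‖ ^ 2) := by
  let φ : ℕ → ContDiffBump (0 : ℝ) := fun n =>
    ⟨1 / (n + 1) / 2, 1 / (n + 1), by positivity, half_lt_self (by positivity)⟩
  have hφ : Tendsto (fun n => (φ n).rOut) atTop (𝓝 0) := tendsto_one_div_add_atTop_nhds_zero_nat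
  have hcont : Continuous (Set.IccExtend hT.le (u - w)) := (u - w).continuous.Icc_extend'
  have hsmall : ∀ᶠ n in atTop, (φ n).rOut < a ∧ b + (φ n).rOut < T := by
    filter_upwards [hφ.eventually (gt_mem_nhds ha),
      hφ.eventually (gt_mem_nhds (sub_pos.2 hb))] with n h1 h2
    exact ⟨h1, by linarith⟩
  have hlim : ∀ t, a ≤ t → t ≤ b → Tendsto (fun n => mollify ((φ n).normed volume) (u - w) t)
      atTop (𝓝 (Set.IccExtend hT.le (u - w) t)) := by
    intro t hat htb
    refine (ContDiffBump.convolution_tendsto_right_of_continuous (μ := volume) hφ hcont t).congr' ?_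
    filter_upwards [hsmall] with n hn
    exact (mollify_eq_convolution (φ n).support_normed_eq.subset (by linarith [hn.1])
      (by linarith [hn.2]) hT.le _).symm
  refine le_of_tendsto_of_tendsto
    ((((hlim b hab le_rfl).norm.pow 2).add_const _).const_mul _)
    ((((hlim a le_rfl hab).norm.pow 2).add_const _).const_mul _) ?_
  filter_upwards [hsmall] with n hn
  exact mollified_energy hT hu hw (φ n).contDiff_normed (φ n).hasCompactSupport_normed
    (φ n).nonneg_normed (φ n).integral_normed (φ n).tsupport_normed_eq.subset hn.1 hab hn.2

/-- The energy estimate for the difference of two weak solutions. -/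
theorem energy_estimate {D : Set Plane} {T : ℝ} (hT : 0 < T)
    {f g u w : C(Set.Icc (0 : ℝ) T, L2 D)} (hu : IsWeakSolution D hT f u)
    (hw : IsWeakSolution D hT g w) (t : Set.Icc (0 : ℝ) T) :
    ‖u t - w t‖ ≤ Real.exp T * ‖f - g‖ := by
  set Z : ℝ → L2 D := Set.IccExtend hT.le (u - w : C(Set.Icc (0 : ℝ) T, L2 D)) with hZ
  have hcont : Continuous Z := (u - w).continuous.Icc_extend'
  have hZ0 : Z 0 = 0 := by
    have := Set.IccExtend_left hT.le (u - w)
    rw [hZ, this]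
    simp [hu.initial, hw.initial]
  set q : ℝ → ℝ := fun t => Real.exp (-t) * (‖Z t‖ ^ 2 + ‖f - g‖ ^ 2) with hq
  have hqc : Continuous q := by fun_prop
  have hint : ∀ b ∈ Set.Ioo 0 T, q b ≤ q 0 := by
    intro b hb
    -- Let a → 0⁺; the closure argument below then reaches b = T.
    refine ge_of_tendsto (hqc.continuousAt.tendsto.mono_left
      (nhdsWithin_le_nhds (s := Set.Ioi 0))) ?_
    filter_upwards [Ioo_mem_nhdsGT hb.1] with a ha
    exact energy_interior hT hu hw ha.1 ha.2.le hb.2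
  have hall : ∀ b ∈ Set.Icc 0 T, q b ≤ q 0 := by
    rw [← closure_Ioo hT.ne]
    exact closure_minimal hint (isClosed_le hqc continuous_const)
  have h := hall t t.2
  have hZt : Z t = u t - w t := by simp [hZ]
  simp only [hq, hZ0, hZt, Real.exp_neg, norm_zero, Real.exp_zero] at h
  have hexp : Real.exp t ≤ Real.exp T := Real.exp_le_exp.2 t.2.2
  have hone : 1 ≤ Real.exp T := Real.one_le_exp hT.le
  rw [inv_mul_le_iff₀ (Real.exp_pos _)] at h
  refine (pow_le_pow_iff_left₀ (norm_nonneg _) (by positivity) two_ne_zero).1 ?_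
  -- Here ‖u - w‖² + ‖f - g‖² ≤ e^t ‖f - g‖², and e^t ≤ e^T ≤ (e^T)², whence the constant e^T.
  have h5 : Real.exp t * ‖f - g‖ ^ 2 ≤ Real.exp T ^ 2 * ‖f - g‖ ^ 2 :=
    mul_le_mul_of_nonneg_right (by nlinarith) (sq_nonneg _)
  rw [mul_pow]
  nlinarith [sq_nonneg ‖f - g‖]

end HeatPerturbation

theorem mainTheorem7 (D : Set HeatPerturbation.Plane) (hDopen : IsOpen D)
    (hDbdd : Bornology.IsBounded D) (T : ℝ) (hT : 0 < T) :
    ∃ C : ℝ, 0 < C ∧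
      ∀ f g u w : C(Set.Icc (0 : ℝ) T, HeatPerturbation.L2 D),
        HeatPerturbation.IsWeakSolution D hT f u →
        HeatPerturbation.IsWeakSolution D hT g w →
        ∀ N : ℕ, 1 ≤ N → ∀ m : Fin (N + 1),
          ‖u (HeatPerturbation.timeNode hT N m) - w (HeatPerturbation.timeNode hT N m)‖
            ≤ C * ‖f - g‖ := by
  exact ⟨Real.exp T, Real.exp_pos T, fun f g u w hu hw N _ m =>
    HeatPerturbation.energy_estimate hT hu hw (HeatPerturbation.timeNode hT N m)⟩
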